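/- **Setting.** Let $\Omega\in\mathbb{R}^{p\times d}$ have rows $w_1^T,\dots,w_p^T$ of unit Euclidean norm; for $\Lambda\subseteq\{1,\dots,p\}$ let $\Omega_\Lambda$ be the submatrix of the rows indexed by $\Lambda$. The co-support of $x\in\mathbb{R}^d$ is $\Lambda=\{j: w_j^Tx=0\}$, its co-sparsity is $\ell=|\Lambda|$, its co-rank is $\operatorname{rank}(\Omega_\Lambda)$, and $z_{\min}=\min_{j\notin\Lambda}|w_j^Tx|$ (equal to $+\infty$ if $\Lambda=\{1,\dots,p\}$). The *analysis thresholding algorithm* with input $\Omega$, $y\in\mathbb{R}^d$, target co-rank $k$ and refinement threshold $\varepsilon_0>0$ does the following. It sorts $\{1,\dots,p\}$ by increasing $|w_j^Ty|$ (ties in any order); starting from $\tilde\Lambda=\emptyset$, it adds indices to $\tilde\Lambda$ one by one in this order as long as $\operatorname{rank}(\Omega_{\tilde\Lambda})<k$; it computes $\hat x=(I-\Omega_{\tilde\Lambda}^\dagger\Omega_{\tilde\Lambda})y$, the orthogonal projection of $y$ onto the subspace orthogonal to the selected rows; and it returns $\hat\Lambda=\{j: |w_j^T\hat x|<\varepsilon_0\}$.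 It recovers $\Lambda$ from $y$ if $\hat\Lambda=\Lambda$, however ties are broken. **Theorem 1.** Let $\sigma>0$ and $\beta>0$. For every sufficiently small threshold $\varepsilon_0>0$ (how small depends only on $\Omega$, $\sigma$ and $\beta$) the following holds. Let $x\in\mathbb{R}^d$ have co-support $\Lambda$, co-sparsity $\ell$ and co-rank $d-r$ with $0\le r\le d$, and let $y=x+e$ with $e\sim N(0,\sigma^2I)$. If $z_{\min}\ge\beta\sigma$, then the thresholding algorithm with target co-rank $d-r$ and threshold $\varepsilon_0$ recovers $\Lambda$ from $y$ with probability at least $g(\beta)^{\,p-\ell+d-r}$, where $$g(\beta)=\max\Bigl\{0,\;1-\sqrt{\tfrac{8}{\pi\beta^2}}\;\exp\bigl(-\tfrac{\beta^2}{8}\bigr)\Bigr\}.$$ -/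

import Mathlib

open MeasureTheory ProbabilityTheory

namespace AnalysisModel

variable {p d : ℕ}

/-- The `j`-th row `w_j` of the analysis dictionary `Ω`, as a vector of Euclidean space. -/
def row (Ω : Matrix (Fin p) (Fin d) ℝ) (j : Fin p) : EuclideanSpace ℝ (Fin d) :=
  WithLp.toLp 2 (Ω j)

/-- The submatrix `Ω_Λ` of `Ω` that keeps only the rows indexed by `Λ`. -/
def subDict (Ω : Matrix (Fin p) (Fin d) ℝ) (Λ : Finset (Fin p)) : Matrix Λ (Fin d) ℝ :=
  Ω.submatrix Subtype.val id

open Classical in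
/-- The co-support of `x`: the indices of all the zeros of `Ω x`. -/
noncomputable def cosupport (Ω : Matrix (Fin p) (Fin d) ℝ) (x : EuclideanSpace ℝ (Fin d)) :
    Finset (Fin p) :=
  Finset.univ.filter fun j => inner ℝ (row Ω j) x = 0

/-- The smallest absolute inner product of `x` with a row outside the co-support, with the
convention that the minimum over the empty set is `+∞`. -/
noncomputable def zMin (Ω : Matrix (Fin p) (Fin d) ℝ) (x : EuclideanSpace ℝ (Fin d)) : EReal :=
  ⨅ j ∈ (cosupport Ω x)ᶜ, ((|inner ℝ (row Ω j) x| : ℝ) : EReal)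

/-- `Γ` lists the row indices in increasing order of `|w_k^T y|` (ties in any order). -/
def IsSortingOrder (Ω : Matrix (Fin p) (Fin d) ℝ) (y : EuclideanSpace ℝ (Fin d))
    (Γ : Equiv.Perm (Fin p)) : Prop :=
  Monotone fun i => |inner ℝ (row Ω (Γ i)) y|

/-- The `while` loop: as long as the rank of the rows collected in `Λ` is below the target
co-rank `k`, move the next index of the list into `Λ`. -/
noncomputable def selectLoop (Ω : Matrix (Fin p) (Fin d) ℝ) (k : ℕ) :
    List (Fin p) → Finset (Fin p) → Finset (Fin p)
  | [], Λ => Λ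
  | j :: L, Λ => if (subDict Ω Λ).rank < k then selectLoop Ω k L (insert j Λ) else Λ

/-- The rows selected by the loop when it starts from the empty set and reads the indices in
the order `Γ 0, Γ 1, …`. -/
noncomputable def selectRows (Ω : Matrix (Fin p) (Fin d) ℝ) (k : ℕ) (Γ : Equiv.Perm (Fin p)) :
    Finset (Fin p) :=
  selectLoop Ω k (List.ofFn Γ) ∅

/-- The orthogonal projection of `y` onto the subspace orthogonal to the rows indexed by `Λ`,
that is, `(I - Ω_Λ^† Ω_Λ) y`. -/
noncomputable def project (Ω : Matrix (Fin p) (Fin d) ℝ) (Λ : Finset (Fin p))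
    (y : EuclideanSpace ℝ (Fin d)) : EuclideanSpace ℝ (Fin d) :=
  (Submodule.span ℝ (row Ω '' (Λ : Set (Fin p))))ᗮ.starProjection y

open Classical in
/-- The co-support returned by the analysis thresholding algorithm with target co-rank `k` and
refinement threshold `ε₀`, when its sorting step produced the order `Γ`. -/
noncomputable def thresholding (Ω : Matrix (Fin p) (Fin d) ℝ) (k : ℕ) (ε₀ : ℝ)
    (y : EuclideanSpace ℝ (Fin d)) (Γ : Equiv.Perm (Fin p)) : Finset (Fin p) :=
  Finset.univ.filter fun j => |inner ℝ (row Ω j) (project Ω (selectRows Ω k Γ) y)| < ε₀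

/-- The thresholding algorithm recovers `Λ` from `y`, however its sorting step breaks ties. -/
def Recovers (Ω : Matrix (Fin p) (Fin d) ℝ) (k : ℕ) (ε₀ : ℝ)
    (y : EuclideanSpace ℝ (Fin d)) (Λ : Finset (Fin p)) : Prop :=
  ∀ Γ : Equiv.Perm (Fin p), IsSortingOrder Ω y Γ → thresholding Ω k ε₀ y Γ = Λ

/-- The base `g(β)` of the probability bound (for `β > 0`). -/
noncomputable def g (β : ℝ) : ℝ :=
  max 0 (1 - √(8 / (Real.pi * β ^ 2)) * Real.exp (-(β ^ 2) / 8))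

end AnalysisModel

/-!
The algorithm succeeds on a simple event. Let `J` be a subset of the co-support `Λ` whose rows are
a basis of the span of the rows of `Λ`, so that `J` has `d - r` elements. If `|⟨w_j, e⟩| < βσ/2`
for all `j` in `J` and all `j` outside `Λ`, then in `y = x + e` every index of `J` comes strictly
before every index outside `Λ`; the loop therefore reaches its target rank while it has only seen
indices of `Λ` (`selectLoop_subset`), and the selected rows span the same space as those of `Λ`.
The projection then annihilates the rows of `Λ`, and the refinement step succeeds unless one of
the numbers `⟨w_i, x⟩ + ⟨u_i, e⟩`, `i ∉ Λ`, is smaller than `ε₀`, where `u_i ≠ 0` is the part of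
`w_i` orthogonal to the rows of `Λ` (`recovers_of_lt`).

The first event is an intersection of `(p - l) + (d - r)` slabs, not independent in general, and
its probability is at least the product of the individual ones by Šidák's inequality
(`pow_card_le_measureReal_slabs`). That inequality is proved one slab `{|⟨w, z⟩| < t}` at a time:
the Gaussian measure of the section of a symmetric convex set at height `s` along `w` is an even
log-concave function of `s`, hence decreasing in `|s|`, and Chebyshev's association inequality
applies. Log-concavity of the section function is the one-dimensional Prékopa–Leindler inequality
(`prekopa_leindler`), integrated over one coordinate after the other.

Each slab has probability strictly larger than `g β`, since the Mills ratio bound is strict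
(`g_lt_measureReal`). Only finitely many exponents can occur, so that the gap between the two powers
is bounded below by a constant that depends on `p`, `d` and `β` only. The second kind of failure
is a union of at most `p` events of the form `|a + ⟨u, e⟩| < ε₀` with `u ≠ 0` from a finite list
that depends on `Ω` only; their probabilities tend to `0` with `ε₀`, uniformly in `a`
(`exists_measureReal_abs_lt_le`), and so they fit into the gap uniformly in `x`.
-/

namespace AnalysisModel

/-! ### The Prékopa–Leindler inequality on the line -/

/-- The Brunn–Minkowski inequality on the line, for compact sets: the translates `K + min L` and
`max K + L` lie in `K + L` and share a single point. -/
theorem volume_add_le_of_isCompact {K L C : Set ℝ} (hK : IsCompact K) (hL : IsCompact L)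
    (hK0 : K.Nonempty) (hL0 : L.Nonempty) (h : ∀ x ∈ K, ∀ y ∈ L, x + y ∈ C) :
    volume K + volume L ≤ volume C := by
  have hk := hK.sSup_mem hK0
  have hl := hL.sInf_mem hL0
  have h1 : volume ((fun x => x + sInf L) '' K) = volume K := by
    rw [Set.image_add_right, measure_preimage_add_right]
  have h2 : volume ((fun y => sSup K + y) '' L) = volume L := by
    rw [Set.image_add_left, measure_preimage_add]
  have hm2 : MeasurableSet ((fun y => sSup K + y) '' L) :=
    (hL.image (by fun_prop)).isClosed.measurableSet
  have hd : AEDisjoint volume ((fun x => x + sInf L) '' K) ((fun y => sSup K + y) '' L) := by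
    refine measure_mono_null (t := {sSup K + sInf L}) ?_ (by simp)
    rintro _ ⟨⟨x, hx, rfl⟩, ⟨y, hy, hxy⟩⟩
    have := le_csSup hK.bddAbove hx
    have := csInf_le hL.bddBelow hy
    simp only [Set.mem_singleton_iff] at hxy ⊢
    linarith
  rw [← h1, ← h2, ← measure_union₀ hm2.nullMeasurableSet hd]
  apply measure_mono
  rintro _ (⟨x, hx, rfl⟩ | ⟨y, hy, rfl⟩)
  · exact h _ hx _ hl
  · exact h _ hk _ hy

/-- The Brunn–Minkowski inequality on the line, for nonempty measurable sets. -/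
theorem volume_add_le {A B C : Set ℝ} (hA : MeasurableSet A) (hB : MeasurableSet B)
    (hA0 : A.Nonempty) (hB0 : B.Nonempty) (h : ∀ x ∈ A, ∀ y ∈ B, x + y ∈ C) :
    volume A + volume B ≤ volume C := by
  obtain ⟨x₀, hx₀⟩ := hA0
  obtain ⟨y₀, hy₀⟩ := hB0
  rw [hA.measure_eq_iSup_isCompact, hB.measure_eq_iSup_isCompact]
  simp only [iSup_and']
  refine ENNReal.biSup_add_biSup_le' (p := fun K => K ⊆ A ∧ IsCompact K)
    (q := fun K => K ⊆ B ∧ IsCompact K) ⟨∅, by simp⟩ ⟨∅, by simp⟩ fun K hK L hL => ?_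
  -- a point is added to each compact set, to make it nonempty
  refine (add_le_add (measure_mono (Set.subset_insert x₀ K))
    (measure_mono (Set.subset_insert y₀ L))).trans ?_
  refine volume_add_le_of_isCompact (hK.2.insert _) (hL.2.insert _) (Set.insert_nonempty _ _)
    (Set.insert_nonempty _ _) fun x hx y hy => h x ?_ y ?_
  · exact Set.insert_subset hx₀ hK.1 hx
  · exact Set.insert_subset hy₀ hL.1 hy

open scoped Pointwise in
/-- The Prékopa–Leindler inequality for functions of supremum `1`, in the stronger arithmetic form:
for `0 < t < 1` the superlevel sets of `f` and `g` at height `t` are nonempty, and the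
Brunn–Minkowski inequality applies to them. -/
theorem prekopa_normalized {f g h : ℝ → ℝ} {a b : ℝ} (ha : 0 < a) (hb : 0 < b) (hab : a + b = 1)
    (hf : Measurable f) (hg : Measurable g) (hh : Measurable h)
    (hf0 : ∀ x, 0 ≤ f x) (hg0 : ∀ x, 0 ≤ g x) (hh0 : ∀ x, 0 ≤ h x)
    (hf1 : ∀ x, f x ≤ 1) (hg1 : ∀ x, g x ≤ 1)
    (hfs : ∀ t < 1, ∃ x, t < f x) (hgs : ∀ t < 1, ∃ x, t < g x)
    (H : ∀ x y, f x ^ a * g y ^ b ≤ h (a * x + b * y)) :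
    ENNReal.ofReal a * (∫⁻ x, ENNReal.ofReal (f x))
      + ENNReal.ofReal b * (∫⁻ x, ENNReal.ofReal (g x)) ≤ ∫⁻ x, ENNReal.ofReal (h x) := by
  rw [lintegral_eq_lintegral_meas_lt _ (.of_forall hf0) hf.aemeasurable,
    lintegral_eq_lintegral_meas_lt _ (.of_forall hg0) hg.aemeasurable,
    lintegral_eq_lintegral_meas_lt _ (.of_forall hh0) hh.aemeasurable,
    ← lintegral_const_mul' _ _ ENNReal.ofReal_ne_top,
    ← lintegral_const_mul' _ _ ENNReal.ofReal_ne_top]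
  refine (le_lintegral_add _ _).trans (setLIntegral_mono' measurableSet_Ioi fun t ht => ?_)
  rw [Set.mem_Ioi] at ht
  rcases le_or_gt 1 t with h1 | h1
  · have e1 : {x | t < f x} = ∅ := by
      ext x; simpa using (hf1 x).trans h1
    have e2 : {x | t < g x} = ∅ := by
      ext x; simpa using (hg1 x).trans h1
    simp [e1, e2]
  have hs : ∀ (c : ℝ) (s : Set ℝ), 0 < c → ENNReal.ofReal c * volume s = volume (c • s) := by
    intro c s hc
    rw [Measure.addHaar_smul]; simp [abs_of_pos hc]
  rw [hs a _ ha, hs b _ hb]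
  apply volume_add_le
  · exact (measurableSet_lt measurable_const hf).const_smul_of_ne_zero ha.ne'
  · exact (measurableSet_lt measurable_const hg).const_smul_of_ne_zero hb.ne'
  · exact Set.Nonempty.smul_set (hfs t h1)
  · exact Set.Nonempty.smul_set (hgs t h1)
  rintro _ ⟨x, hx, rfl⟩ _ ⟨y, hy, rfl⟩
  simp only [Set.mem_ofPred_eq, smul_eq_mul] at hx hy ⊢
  refine lt_of_lt_of_le ?_ (H x y)
  calc t = t ^ a * t ^ b := by rw [← Real.rpow_add ht, hab, Real.rpow_one]
    _ < f x ^ a * g y ^ b := by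
      apply mul_lt_mul'' (Real.rpow_lt_rpow ht.le hx ha) (Real.rpow_lt_rpow ht.le hy hb) <;>
        positivity

/-- The Prékopa–Leindler inequality on the line. -/
theorem prekopa_leindler {f g h : ℝ → ℝ} {a b M : ℝ} (ha : 0 < a) (hb : 0 < b) (hab : a + b = 1)
    (hf : Integrable f) (hg : Integrable g) (hh : Integrable h)
    (hfm : Measurable f) (hgm : Measurable g) (hhm : Measurable h)
    (hf0 : ∀ x, 0 ≤ f x) (hg0 : ∀ x, 0 ≤ g x) (hh0 : ∀ x, 0 ≤ h x)
    (hfM : ∀ x, f x ≤ M) (hgM : ∀ x, g x ≤ M)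
    (H : ∀ x y, f x ^ a * g y ^ b ≤ h (a * x + b * y)) :
    (∫ x, f x) ^ a * (∫ x, g x) ^ b ≤ ∫ x, h x := by
  have hI : 0 ≤ ∫ x, h x := integral_nonneg hh0
  by_cases hfz : ∀ x, f x = 0
  · simpa [hfz, Real.zero_rpow ha.ne'] using hI
  by_cases hgz : ∀ x, g x = 0
  · simpa [hgz, Real.zero_rpow hb.ne'] using hI
  push Not at hfz hgz
  have hbf : BddAbove (Set.range f) := ⟨M, by rintro _ ⟨x, rfl⟩; exact hfM x⟩
  have hbg : BddAbove (Set.range g) := ⟨M, by rintro _ ⟨x, rfl⟩; exact hgM x⟩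
  set F := ⨆ x, f x
  set G := ⨆ x, g x
  have hF : 0 < F := by
    obtain ⟨x, hx⟩ := hfz
    exact ((hf0 x).lt_of_ne' hx).trans_le (le_ciSup hbf x)
  have hG : 0 < G := by
    obtain ⟨x, hx⟩ := hgz
    exact ((hg0 x).lt_of_ne' hx).trans_le (le_ciSup hbg x)
  have hc : 0 < F ^ a * G ^ b := by positivity
  have key := prekopa_normalized (f := fun x => f x / F) (g := fun x => g x / G)
    (h := fun x => h x / (F ^ a * G ^ b)) ha hb hab (hfm.div_const _) (hgm.div_const _)
    (hhm.div_const _) (fun x => div_nonneg (hf0 x) hF.le) (fun x => div_nonneg (hg0 x) hG.le)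
    (fun x => div_nonneg (hh0 x) hc.le)
    (fun x => (div_le_one hF).2 (le_ciSup hbf x)) (fun x => (div_le_one hG).2 (le_ciSup hbg x))
    (fun t ht => ?_) (fun t ht => ?_) (fun x y => ?_)
  rotate_left
  · obtain ⟨x, hx⟩ := exists_lt_of_lt_ciSup (show t * F < ⨆ x, f x from by
      change t * F < F; nlinarith)
    exact ⟨x, by rwa [lt_div_iff₀ hF]⟩
  · obtain ⟨x, hx⟩ := exists_lt_of_lt_ciSup (show t * G < ⨆ x, g x from by
      change t * G < G; nlinarith)
    exact ⟨x, by rwa [lt_div_iff₀ hG]⟩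
  · rw [Real.div_rpow (hf0 x) hF.le, Real.div_rpow (hg0 y) hG.le, div_mul_div_comm]
    exact div_le_div_of_nonneg_right (H x y) hc.le
  rw [← ofReal_integral_eq_lintegral_ofReal (hf.div_const _)
      (.of_forall fun x => div_nonneg (hf0 x) hF.le),
    ← ofReal_integral_eq_lintegral_ofReal (hg.div_const _)
      (.of_forall fun x => div_nonneg (hg0 x) hG.le),
    ← ofReal_integral_eq_lintegral_ofReal (hh.div_const _)
      (.of_forall fun x => div_nonneg (hh0 x) hc.le),
    integral_div, integral_div, integral_div, ← ENNReal.ofReal_mul ha.le,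
    ← ENNReal.ofReal_mul hb.le] at key
  have hfi : 0 ≤ ∫ x, f x := integral_nonneg hf0
  have hgi : 0 ≤ ∫ x, g x := integral_nonneg hg0
  rw [← ENNReal.ofReal_add (by positivity) (by positivity),
    ENNReal.ofReal_le_ofReal_iff (by positivity)] at key
  have am := (Real.geom_mean_le_arith_mean2_weighted ha.le hb.le (div_nonneg hfi hF.le)
    (div_nonneg hgi hG.le) hab).trans key
  rwa [Real.div_rpow hfi hF.le, Real.div_rpow hgi hG.le, div_mul_div_comm,
    div_le_div_iff_of_pos_right hc] at am

/-! ### Log-concave functions and their Gaussian marginals -/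

/-- Log-concavity of a nonnegative function, in multiplicative form, so that zeros are allowed. -/
def LogConcave {E : Type*} [AddCommGroup E] [Module ℝ E] (f : E → ℝ) : Prop :=
  ∀ x y : E, ∀ a b : ℝ, 0 < a → 0 < b → a + b = 1 → f x ^ a * f y ^ b ≤ f (a • x + b • y)

theorem logConcave_gaussianPDFReal : LogConcave (gaussianPDFReal 0 1) := by
  intro x y a b ha hb hab
  have hc : 0 < (√(2 * Real.pi * (1 : NNReal)))⁻¹ := by positivity
  simp only [gaussianPDFReal_def, smul_eq_mul, sub_zero]
  rw [Real.mul_rpow hc.le (Real.exp_pos _).le, Real.mul_rpow hc.le (Real.exp_pos _).le,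
    mul_mul_mul_comm, ← Real.rpow_add hc, hab, Real.rpow_one, ← Real.exp_mul, ← Real.exp_mul,
    ← Real.exp_add]
  refine mul_le_mul_of_nonneg_left (Real.exp_le_exp.2 ?_) hc.le
  obtain rfl : b = 1 - a := by linarith
  simp only [NNReal.coe_one, mul_one]
  nlinarith [mul_nonneg (mul_nonneg ha.le hb.le) (sq_nonneg (x - y))]

/-- Gaussian marginals of log-concave functions are log-concave: the product with the Gaussian
density is log-concave, and the Prékopa–Leindler inequality applies. The bound `f ≤ 1` serves
integrability. -/
theorem LogConcave.integral_gaussianReal {E : Type*} [AddCommGroup E] [Module ℝ E]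
    {f : E × ℝ → ℝ} (hf : LogConcave f) (hm : ∀ x, Measurable fun t => f (x, t))
    (h0 : ∀ x, 0 ≤ f x) (h1 : ∀ x, f x ≤ 1) :
    LogConcave fun x => ∫ t, f (x, t) ∂gaussianReal 0 1 := by
  intro x y a b ha hb hab
  have hp := gaussianPDFReal_nonneg 0 1
  have hpm := measurable_gaussianPDFReal 0 1
  have hi : ∀ x, Integrable fun t => gaussianPDFReal 0 1 t * f (x, t) := fun x =>
    (integrable_gaussianPDFReal 0 1).mul_bdd (c := 1) (hm x).aestronglyMeasurable
      (.of_forall fun t => by rw [Real.norm_of_nonneg (h0 _)]; exact h1 _)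
  simp only [integral_gaussianReal_eq_integral_smul one_ne_zero, smul_eq_mul]
  have hM : ∀ x t, gaussianPDFReal 0 1 t * f (x, t) ≤ (√(2 * Real.pi))⁻¹ := by
    intro x t
    have : gaussianPDFReal 0 1 t ≤ (√(2 * Real.pi))⁻¹ := by
      simp only [gaussianPDFReal_def, NNReal.coe_one, mul_one, sub_zero]
      refine mul_le_of_le_one_right (by positivity) (Real.exp_le_one_iff.2 ?_)
      have := sq_nonneg t
      linarith
    exact (mul_le_of_le_one_right (hp t) (h1 _)).trans this
  refine prekopa_leindler ha hb hab (hi x) (hi y) (hi _) (hpm.mul (hm _)) (hpm.mul (hm _))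
    (hpm.mul (hm _)) (fun t => mul_nonneg (hp t) (h0 _)) (fun t => mul_nonneg (hp t) (h0 _))
    (fun t => mul_nonneg (hp t) (h0 _)) (hM x) (hM y) fun s t => ?_
  rw [Real.mul_rpow (hp _) (h0 _), Real.mul_rpow (hp _) (h0 _), mul_mul_mul_comm]
  refine mul_le_mul (logConcave_gaussianPDFReal s t a b ha hb hab)
    (hf (x, s) (y, t) a b ha hb hab) ?_ (hp _)
  exact mul_nonneg (Real.rpow_nonneg (h0 _) _) (Real.rpow_nonneg (h0 _) _)

theorem LogConcave.integral_pi_gaussianReal {n : ℕ} {E : Type*} [AddCommGroup E] [Module ℝ E]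
    {f : E × (Fin n → ℝ) → ℝ} (hf : LogConcave f) (hm : ∀ x, Measurable fun z => f (x, z))
    (h0 : ∀ x, 0 ≤ f x) (h1 : ∀ x, f x ≤ 1) :
    LogConcave fun x => ∫ z, f (x, z) ∂Measure.pi fun _ : Fin n => gaussianReal 0 1 := by
  induction n with
  | zero =>
    intro x y a b ha hb hab
    have e : ∀ x, ∫ z, f (x, z) ∂(Measure.pi fun _ : Fin 0 => gaussianReal 0 1)
        = f (x, default) := fun x => by
      have : (fun z => f (x, z)) = fun _ => f (x, default) :=
        funext fun z => by rw [Subsingleton.elim z default]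
      rw [this, integral_const]
      simp
    have h := hf (x, default) (y, default) a b ha hb hab
    simp only [e]
    refine h.trans_eq ?_
    rw [Prod.smul_mk, Prod.smul_mk, Prod.mk_add_mk,
      Subsingleton.elim (a • (default : Fin 0 → ℝ) + b • (default : Fin 0 → ℝ)) default]
  | succ n ih =>
    have hmp := measurePreserving_piFinSuccAbove (fun _ : Fin (n + 1) => gaussianReal 0 1) 0
    have hbd : ∀ (x : E) {X : Type _} [MeasurableSpace X] (φ : X → Fin (n + 1) → ℝ)
        (μ : Measure X) [IsFiniteMeasure μ], Measurable φ → Integrable (fun z => f (x, φ z)) μ := by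
      intro x X _ φ μ _ hφ
      exact Integrable.of_bound ((hm x).comp hφ).aestronglyMeasurable 1
        (.of_forall fun t => by rw [Real.norm_of_nonneg (h0 _)]; exact h1 _)
    have hcm : Measurable fun q : (Fin n → ℝ) × ℝ => (Fin.cons q.2 q.1 : Fin (n + 1) → ℝ) := by
      refine measurable_pi_lambda _ fun i => ?_
      refine Fin.cases ?_ (fun i => ?_) i
      · simpa using measurable_snd
      · simp only [Fin.cons_succ]; fun_prop
    -- coordinate `0` is integrated first, with the remaining ones as parameters
    have key : LogConcave fun q : E × (Fin n → ℝ) =>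
        ∫ t, f (q.1, Fin.cons t q.2) ∂gaussianReal 0 1 := by
      refine LogConcave.integral_gaussianReal
        (f := fun q : (E × (Fin n → ℝ)) × ℝ => f (q.1.1, Fin.cons q.2 q.1.2)) ?_ ?_ ?_ ?_
      · intro x y a b ha hb hab
        refine (hf _ _ a b ha hb hab).trans_eq ?_
        congr 1
        simp only [Prod.smul_mk, Prod.mk_add_mk]
        congr 1
        funext i
        refine Fin.cases ?_ (fun i => ?_) i <;> simp
      · exact fun x => (hm x.1).comp (hcm.comp ((measurable_const (a := x.2)).prodMk measurable_id))
      · exact fun x => h0 _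
      · exact fun x => h1 _
    have := ih key ?_ ?_ ?_
    · convert this using 2 with x
      rw [← hmp.symm.integral_comp (MeasurableEquiv.measurableEmbedding _), integral_prod_symm]
      · refine integral_congr_ae (.of_forall fun z => integral_congr_ae (.of_forall fun t => ?_))
        simp [MeasurableEquiv.piFinSuccAbove]
        rfl
      · exact hbd x _ _ (MeasurableEquiv.measurable _)
    · intro x
      have : StronglyMeasurable fun q : (Fin n → ℝ) × ℝ => f (x, Fin.cons q.2 q.1) :=
        ((hm x).comp hcm).stronglyMeasurable
      exact this.integral_prod_right.measurable
    · exact fun q => integral_nonneg fun t => h0 _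
    · intro q
      refine (integral_mono (g := fun _ => (1 : ℝ)) ?_ (integrable_const _) fun t => h1 _).trans
        (by simp)
      exact hbd _ _ _ (hcm.comp (measurable_const.prodMk measurable_id))

theorem logConcave_indicator_linearMap {V E : Type*} [AddCommGroup V] [Module ℝ V]
    [AddCommGroup E] [Module ℝ E] {K : Set E} (hK : Convex ℝ K) (A : V →ₗ[ℝ] E) :
    LogConcave fun v => K.indicator (fun _ => (1 : ℝ)) (A v) := by
  intro x y a b ha hb hab
  by_cases hx : A x ∈ K
  · by_cases hy : A y ∈ K
    · have : A (a • x + b • y) ∈ K := by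
        simpa using hK hx hy ha.le hb.le hab
      beta_reduce
      rw [Set.indicator_of_mem this]
      simp [hx, hy]
    · simp [hy, Real.zero_rpow hb.ne', Set.indicator_nonneg]
  · simp [hx, Real.zero_rpow ha.ne', Set.indicator_nonneg]

/-- An even log-concave function on the line is decreasing in `|s|`, because `s` is a convex
combination of `t` and `-t`. -/
theorem LogConcave.le_of_abs_le {F : ℝ → ℝ} (hF : LogConcave F) (h0 : ∀ s, 0 ≤ F s)
    (heven : ∀ s, F (-s) = F s) {s t : ℝ} (hst : |s| ≤ |t|) : F t ≤ F s := by
  rcases hst.eq_or_lt with h | h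
  · rcases abs_eq_abs.1 h with rfl | rfl
    · exact le_rfl
    · exact (heven t).ge
  have ht : t ≠ 0 := by
    rintro rfl
    exact absurd h (by simp)
  have hc : |s / t| < 1 := by rwa [abs_div, div_lt_one (abs_pos.2 ht)]
  obtain ⟨hc1, hc2⟩ := abs_lt.1 hc
  have key := hF t (-t) ((1 + s / t) / 2) ((1 - s / t) / 2) (by linarith) (by linarith) (by ring)
  rw [heven, ← Real.rpow_add_of_nonneg (h0 t) (by linarith) (by linarith)] at key
  have e1 : (1 + s / t) / 2 + (1 - s / t) / 2 = 1 := by ring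
  have e2 : ((1 + s / t) / 2) • t + ((1 - s / t) / 2) • (-t) = s := by
    simp only [smul_eq_mul]
    field_simp
    ring
  rwa [e1, e2, Real.rpow_one] at key

/-- Chebyshev's association inequality for a function decreasing in `|s|` and the indicator of a
symmetric interval: `F` is at least `F t` on the interval and at most `F t` off it. -/
theorem measureReal_mul_integral_le {μ : Measure ℝ} [IsProbabilityMeasure μ] {F : ℝ → ℝ}
    (hi : Integrable F μ) (hF : ∀ s t, |s| ≤ |t| → F t ≤ F s) {t : ℝ} (ht : 0 < t) :
    μ.real {s | |s| < t} * ∫ s, F s ∂μ ≤ ∫ s in {s | |s| < t}, F s ∂μ := by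
  have hA : MeasurableSet {s : ℝ | |s| < t} := measurableSet_lt (by fun_prop) measurable_const
  rw [← integral_add_compl hA hi]
  have h1 : F t * μ.real {s | |s| < t} ≤ ∫ s in {s | |s| < t}, F s ∂μ := by
    refine setIntegral_ge_of_const_le_real hA (measure_ne_top _ _) (fun s hs => ?_) hi.integrableOn
    exact hF _ _ (by rw [abs_of_pos ht]; exact le_of_lt hs)
  have h2 : ∫ s in {s | |s| < t}ᶜ, F s ∂μ ≤ F t * μ.real {s | |s| < t}ᶜ := by
    have := setIntegral_mono_on (g := fun _ => F t) hi.integrableOn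
      (integrableOn_const (measure_ne_top _ _)) hA.compl fun s hs => hF t s (by
        rw [abs_of_pos ht]; simpa using hs)
    simpa [mul_comm] using this
  have h3 := probReal_add_probReal_compl (μ := μ) hA
  have h4 : 0 ≤ μ.real {s | |s| < t} := measureReal_nonneg
  have h5 : 0 ≤ μ.real {s | |s| < t}ᶜ := measureReal_nonneg
  have h6 := mul_le_mul_of_nonneg_left h2 h4
  have h7 := mul_le_mul_of_nonneg_left h1 h5
  have h8 : μ.real {s | |s| < t} = 1 - μ.real {s | |s| < t}ᶜ := by linarith
  generalize μ.real {s | |s| < t} = A at *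
  generalize μ.real {s | |s| < t}ᶜ = B at *
  generalize ∫ s in {s | |s| < t}, F s ∂μ = I at *
  generalize ∫ s in {s | |s| < t}ᶜ, F s ∂μ = J at *
  subst h8
  linarith

/-! ### Šidák's inequality -/

variable {n : ℕ}

/-- The linear map that removes the component of `z` along the unit vector `w` and puts the
component `s` in its place. -/
noncomputable def replaceComponent (w : EuclideanSpace ℝ (Fin n)) :
    ℝ × EuclideanSpace ℝ (Fin n) →L[ℝ] EuclideanSpace ℝ (Fin n) :=
  (ContinuousLinearMap.id ℝ _ - (innerSL ℝ w).smulRight w) ∘L ContinuousLinearMap.snd ℝ _ _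
    + (ContinuousLinearMap.fst ℝ ℝ (EuclideanSpace ℝ (Fin n))).smulRight w

theorem replaceComponent_apply (w z : EuclideanSpace ℝ (Fin n)) (s : ℝ) :
    replaceComponent w (s, z) = z - inner ℝ w z • w + s • w := by
  simp [replaceComponent]

theorem inner_replaceComponent {w : EuclideanSpace ℝ (Fin n)} (hw : ‖w‖ = 1)
    (z : EuclideanSpace ℝ (Fin n)) (s : ℝ) : inner ℝ w (replaceComponent w (s, z)) = s := by
  simp [replaceComponent_apply, inner_add_right, inner_sub_right, inner_smul_right, hw]

/-- The component of a standard Gaussian vector along a unit vector can be resampled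
independently of the others. -/
theorem map_replaceComponent {w : EuclideanSpace ℝ (Fin n)} (hw : ‖w‖ = 1) :
    ((gaussianReal 0 1).prod (stdGaussian (EuclideanSpace ℝ (Fin n)))).map (replaceComponent w)
      = stdGaussian (EuclideanSpace ℝ (Fin n)) := by
  apply Measure.ext_of_charFun
  ext u
  have hsplit : ∀ q : ℝ × EuclideanSpace ℝ (Fin n),
      Complex.exp (inner ℝ (replaceComponent w q) u * Complex.I)
        = Complex.exp (inner ℝ q.1 (inner ℝ w u) * Complex.I)
          * Complex.exp (inner ℝ q.2 (u - inner ℝ w u • w) * Complex.I) := by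
    rintro ⟨s, z⟩
    rw [← Complex.exp_add, ← add_mul, ← Complex.ofReal_add]
    congr 3
    simp only [replaceComponent_apply, inner_add_left, inner_sub_left, inner_sub_right,
      inner_smul_left, inner_smul_right, real_inner_comm w z]
    simp
    ring
  rw [charFun_apply, integral_map (by fun_prop) (by fun_prop)]
  simp_rw [hsplit]
  rw [integral_prod_mul (fun s : ℝ => Complex.exp (inner ℝ s (inner ℝ w u) * Complex.I))
    (fun z => Complex.exp (inner ℝ z (u - inner ℝ w u • w) * Complex.I)), ← charFun_apply,
    ← charFun_apply, charFun_stdGaussian, charFun_stdGaussian, charFun_gaussianReal,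
    ← Complex.exp_add]
  congr 1
  have : ‖u - inner ℝ w u • w‖ ^ 2 = ‖u‖ ^ 2 - (inner ℝ w u) ^ 2 := by
    rw [norm_sub_sq_real, norm_smul, hw, inner_smul_right, real_inner_comm, mul_one,
      Real.norm_eq_abs, sq_abs]
    ring
  have h2 : ((‖u - inner ℝ w u • w‖ : ℝ) : ℂ) ^ 2
      = (‖u‖ : ℂ) ^ 2 - ((inner ℝ w u : ℝ) : ℂ) ^ 2 := by
    exact_mod_cast this
  rw [h2]
  push_cast
  ring

/-- The Gaussian measure of a set is the Gaussian average of the measures of its sections at height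
`s` along `w`. -/
theorem measureReal_stdGaussian_eq_integral {w : EuclideanSpace ℝ (Fin n)} (hw : ‖w‖ = 1)
    {K : Set (EuclideanSpace ℝ (Fin n))} (hK : MeasurableSet K) :
    (stdGaussian (EuclideanSpace ℝ (Fin n))).real K
      = ∫ s, (stdGaussian (EuclideanSpace ℝ (Fin n))).real {z | replaceComponent w (s, z) ∈ K}
        ∂gaussianReal 0 1 := by
  have hm : MeasurableSet (replaceComponent w ⁻¹' K) := (replaceComponent w).measurable hK
  conv_lhs => rw [← map_replaceComponent hw, measureReal_def,
    Measure.map_apply (replaceComponent w).measurable hK, Measure.prod_apply hm]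
  rw [← integral_toReal (measurable_measure_prodMk_left hm).aemeasurable
    (.of_forall fun s => measure_lt_top _ _)]
  rfl

/-- The sections of a symmetric convex set lose Gaussian measure as they move away from the
origin. -/
theorem measureReal_section_antitone {w : EuclideanSpace ℝ (Fin n)}
    {K : Set (EuclideanSpace ℝ (Fin n))} (hK : MeasurableSet K) (hc : Convex ℝ K)
    (hs : ∀ z ∈ K, -z ∈ K) {s t : ℝ} (hst : |s| ≤ |t|) :
    (stdGaussian (EuclideanSpace ℝ (Fin n))).real {z | replaceComponent w (t, z) ∈ K}
      ≤ (stdGaussian (EuclideanSpace ℝ (Fin n))).real {z | replaceComponent w (s, z) ∈ K} := by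
  have hm : ∀ s, MeasurableSet {z | replaceComponent w (s, z) ∈ K} := fun s =>
    (show Measurable fun z => replaceComponent w (s, z) by fun_prop) hK
  have hF : LogConcave fun s =>
      (stdGaussian (EuclideanSpace ℝ (Fin n))).real {z | replaceComponent w (s, z) ∈ K} := by
    have h := LogConcave.integral_pi_gaussianReal
      (logConcave_indicator_linearMap hc ((replaceComponent w).toLinearMap ∘ₗ
        LinearMap.prodMap LinearMap.id (WithLp.linearEquiv 2 ℝ (Fin n → ℝ)).symm.toLinearMap))
      (fun s => ?_) (fun q => Set.indicator_nonneg (fun _ _ => zero_le_one) _)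
      (fun q => Set.indicator_le_self' (fun _ _ => zero_le_one) _)
    · convert h using 2 with s
      rw [← map_pi_eq_stdGaussian, map_measureReal_apply (by fun_prop) (hm s)]
      have hm' : MeasurableSet (WithLp.toLp 2 ⁻¹' {z | replaceComponent w (s, z) ∈ K}) :=
        (show Measurable (WithLp.toLp 2 : (Fin n → ℝ) → EuclideanSpace ℝ (Fin n)) by fun_prop)
          (hm s)
      rw [← integral_indicator_one hm']
      rfl
    · refine (measurable_const.indicator hK).comp ?_
      change Measurable fun z : Fin n → ℝ => replaceComponent w (s, WithLp.toLp 2 z)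
      fun_prop
  refine hF.le_of_abs_le (fun _ => measureReal_nonneg) (fun s => ?_) hst
  have hneg : (stdGaussian (EuclideanSpace ℝ (Fin n))).map (fun z => -z) = stdGaussian _ :=
    stdGaussian_map (LinearIsometryEquiv.neg ℝ)
  conv_rhs => rw [← hneg]
  rw [map_measureReal_apply measurable_neg (hm s)]
  congr 1
  ext z
  have e : replaceComponent w (-s, z) = -replaceComponent w (s, -z) := by
    rw [← map_neg]; simp
  change replaceComponent w (-s, z) ∈ K ↔ replaceComponent w (s, -z) ∈ K
  rw [e]
  exact ⟨fun h => by simpa using hs _ h, hs _⟩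

/-- A standard Gaussian vector has standard Gaussian components along unit vectors. -/
theorem measureReal_inner_mem {w : EuclideanSpace ℝ (Fin n)} (hw : ‖w‖ = 1) {A : Set ℝ}
    (hA : MeasurableSet A) :
    (stdGaussian (EuclideanSpace ℝ (Fin n))).real {z | inner ℝ w z ∈ A}
      = (gaussianReal 0 1).real A := by
  have hm : MeasurableSet {z : EuclideanSpace ℝ (Fin n) | inner ℝ w z ∈ A} :=
    (show Measurable fun z : EuclideanSpace ℝ (Fin n) => inner ℝ w z by fun_prop) hA
  rw [measureReal_stdGaussian_eq_integral hw hm, ← integral_indicator_one hA]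
  refine integral_congr_ae (.of_forall fun s => ?_)
  simp only [Set.mem_ofPred_eq, inner_replaceComponent hw]
  by_cases h : s ∈ A <;> simp [h]

/-- A slab and a symmetric convex set are positively correlated under the standard Gaussian
measure. -/
theorem measureReal_slab_mul_le {w : EuclideanSpace ℝ (Fin n)} (hw : ‖w‖ = 1)
    {K : Set (EuclideanSpace ℝ (Fin n))} (hK : MeasurableSet K) (hc : Convex ℝ K)
    (hs : ∀ z ∈ K, -z ∈ K) {t : ℝ} (ht : 0 < t) :
    (gaussianReal 0 1).real {s | |s| < t} * (stdGaussian (EuclideanSpace ℝ (Fin n))).real K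
      ≤ (stdGaussian (EuclideanSpace ℝ (Fin n))).real ({z | |inner ℝ w z| < t} ∩ K) := by
  have hm : MeasurableSet {z : EuclideanSpace ℝ (Fin n) | |inner ℝ w z| < t} :=
    measurableSet_lt (by fun_prop) measurable_const
  have hA : MeasurableSet {s : ℝ | |s| < t} := measurableSet_lt (by fun_prop) measurable_const
  have hi : Integrable (fun s => (stdGaussian (EuclideanSpace ℝ (Fin n))).real
      {z | replaceComponent w (s, z) ∈ K}) (gaussianReal 0 1) := by
    refine Integrable.of_bound (C := 1) ?_ (.of_forall fun s => ?_)
    · exact (measurable_measure_prodMk_left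
        ((replaceComponent w).measurable hK)).ennreal_toReal.aestronglyMeasurable
    · rw [Real.norm_of_nonneg measureReal_nonneg]
      exact measureReal_le_one
  rw [measureReal_stdGaussian_eq_integral hw hK,
    measureReal_stdGaussian_eq_integral hw (hm.inter hK)]
  refine (measureReal_mul_integral_le hi
    (fun s t h => measureReal_section_antitone hK hc hs h) ht).trans_eq ?_
  rw [← integral_indicator hA]
  refine integral_congr_ae (.of_forall fun s => ?_)
  simp only [Set.mem_inter_iff, Set.mem_ofPred_eq, inner_replaceComponent hw]
  by_cases h : |s| < t <;> simp [h]

/-- Šidák's inequality for slabs of a common width. -/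
theorem pow_card_le_measureReal_slabs {ι : Type*} (s : Finset ι)
    {w : ι → EuclideanSpace ℝ (Fin n)} (hw : ∀ j, ‖w j‖ = 1) {t : ℝ} (ht : 0 < t) :
    (gaussianReal 0 1).real {s | |s| < t} ^ s.card
      ≤ (stdGaussian (EuclideanSpace ℝ (Fin n))).real {z | ∀ j ∈ s, |inner ℝ (w j) z| < t} := by
  classical
  induction s using Finset.induction_on with
  | empty => simp
  | insert j s hj ih =>
    have e : {z : EuclideanSpace ℝ (Fin n) | ∀ i ∈ insert j s, |inner ℝ (w i) z| < t}
        = {z | |inner ℝ (w j) z| < t} ∩ {z | ∀ i ∈ s, |inner ℝ (w i) z| < t} := by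
      ext z; simp
    rw [e, Finset.card_insert_of_notMem hj, pow_succ']
    refine (mul_le_mul_of_nonneg_left ih measureReal_nonneg).trans
      (measureReal_slab_mul_le (hw j) ?_ ?_ ?_ ht)
    · have : {z : EuclideanSpace ℝ (Fin n) | ∀ i ∈ s, |inner ℝ (w i) z| < t}
          = ⋂ i ∈ s, {z | |inner ℝ (w i) z| < t} := by ext z; simp
      rw [this]
      exact s.measurableSet_biInter fun i _ => measurableSet_lt (by fun_prop) measurable_const
    · intro x hx y hy a b ha hb hab i hi
      have hball := convex_ball (0 : ℝ) t
      have := hball (x := inner ℝ (w i) x) (y := inner ℝ (w i) y)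
        (by simpa using hx i hi) (by simpa using hy i hi) ha hb hab
      simpa [inner_add_right, inner_smul_right] using this
    · intro z hz i hi
      simpa using hz i hi

/-! ### One-dimensional Gaussian estimates -/

theorem hasDerivAt_neg_gaussianPDFReal (s : ℝ) :
    HasDerivAt (fun s => -gaussianPDFReal 0 1 s) (s * gaussianPDFReal 0 1 s) s := by
  simp only [gaussianPDFReal_def, NNReal.coe_one, mul_one, sub_zero]
  have h1 : HasDerivAt (fun s : ℝ => -s ^ 2 / 2) (-s) s := by
    convert! ((hasDerivAt_pow 2 s).neg.div_const 2) using 1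
    ring
  convert! (h1.exp.const_mul (√(2 * Real.pi))⁻¹).neg using 1
  ring

theorem tendsto_gaussianPDFReal_atTop :
    Filter.Tendsto (gaussianPDFReal 0 1) Filter.atTop (nhds 0) := by
  have h1 : Filter.Tendsto (fun s : ℝ => -s ^ 2 / 2) Filter.atTop Filter.atBot := by
    refine Filter.Tendsto.atBot_div_const two_pos ?_
    exact Filter.tendsto_neg_atTop_atBot.comp (Filter.tendsto_pow_atTop two_ne_zero)
  have h2 := (Real.tendsto_exp_atBot.comp h1).const_mul (√(2 * Real.pi))⁻¹
  rw [mul_zero] at h2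
  refine h2.congr fun s => ?_
  simp [gaussianPDFReal_def]

/-- The Mills ratio bound. It is strict, which is what leaves room for the refinement step. -/
theorem measureReal_Ioi_lt {t : ℝ} (ht : 0 < t) :
    (gaussianReal 0 1).real (Set.Ioi t) < gaussianPDFReal 0 1 t / t := by
  have hp := fun s : ℝ => gaussianPDFReal_pos 0 1 s one_ne_zero
  have hint : IntegrableOn (fun s => s * gaussianPDFReal 0 1 s) (Set.Ioi t) :=
    integrableOn_Ioi_deriv_of_nonneg' (fun s _ => hasDerivAt_neg_gaussianPDFReal s)
      (fun s hs => mul_nonneg (ht.trans hs).le (hp s).le)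
      (by simpa using tendsto_gaussianPDFReal_atTop.neg)
  have hval : ∫ s in Set.Ioi t, s * gaussianPDFReal 0 1 s = gaussianPDFReal 0 1 t := by
    rw [integral_Ioi_of_hasDerivAt_of_tendsto' (fun s _ => hasDerivAt_neg_gaussianPDFReal s) hint
      (by simpa using tendsto_gaussianPDFReal_atTop.neg)]
    ring
  have hi := (integrable_gaussianPDFReal 0 1).integrableOn (s := Set.Ioi t)
  rw [measureReal_def, gaussianReal_apply_eq_integral _ one_ne_zero,
    ENNReal.toReal_ofReal (integral_nonneg fun s => (hp s).le), lt_div_iff₀ ht, ← sub_pos,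
    ← hval, ← integral_mul_const, ← integral_sub hint (hi.mul_const _)]
  have hpos : ∀ s ∈ Set.Ioi t,
      0 < s * gaussianPDFReal 0 1 s - gaussianPDFReal 0 1 s * t := fun s hs => by
    have := mul_pos (sub_pos.2 (Set.mem_Ioi.1 hs)) (hp s)
    linarith
  rw [setIntegral_pos_iff_support_of_nonneg_ae ((ae_restrict_mem measurableSet_Ioi).mono
    fun s hs => (hpos s hs).le) (hint.sub (hi.mul_const _)),
    Set.inter_eq_right.2 fun s hs => Function.mem_support.2 (hpos s hs).ne']
  simp

/-- The base `g β` is a strict lower bound for the probability of a slab of half-width `β / 2`: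
it is the Mills ratio bound for both tails. -/
theorem g_lt_measureReal {β : ℝ} (hβ : 0 < β) :
    g β < (gaussianReal 0 1).real {s | |s| < β / 2} := by
  have ht : 0 < β / 2 := by positivity
  have hA : MeasurableSet {s : ℝ | |s| < β / 2} :=
    measurableSet_lt (by fun_prop) measurable_const
  have hatom : NullSingletonClass (gaussianReal 0 1) := nullSingletonClass_gaussianReal one_ne_zero
  have hneg : (gaussianReal 0 1).real (Set.Iio (-(β / 2)))
      = (gaussianReal 0 1).real (Set.Ioi (β / 2)) := by
    have := gaussianReal_map_neg (μ := 0) (v := 1)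
    rw [neg_zero] at this
    conv_lhs => rw [← this]
    rw [map_measureReal_apply measurable_neg measurableSet_Iio]
    congr 1
    ext s
    simp
  have hcompl : {s : ℝ | |s| < β / 2}ᶜ = Set.Ici (β / 2) ∪ Set.Iic (-(β / 2)) := by
    ext s
    simp [le_abs, le_neg]
  have hIci : (gaussianReal 0 1).real (Set.Ici (β / 2))
      = (gaussianReal 0 1).real (Set.Ioi (β / 2)) :=
    measureReal_congr Ioi_ae_eq_Ici.symm
  have hIic : (gaussianReal 0 1).real (Set.Iic (-(β / 2)))
      = (gaussianReal 0 1).real (Set.Iio (-(β / 2))) :=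
    measureReal_congr Iio_ae_eq_Iic.symm
  have hu := measureReal_union_le (μ := gaussianReal 0 1) (Set.Ici (β / 2)) (Set.Iic (-(β / 2)))
  rw [← hcompl, hIci, hIic, hneg] at hu
  have hm := measureReal_Ioi_lt ht
  have hone := probReal_add_probReal_compl (μ := gaussianReal 0 1) hA
  refine max_lt ?_ ?_
  · refine ENNReal.toReal_pos (fun h0 => ?_) (measure_ne_top _ _)
    have hv := gaussianReal_absolutelyContinuous' 0 (one_ne_zero (α := NNReal)) h0
    have hball : {s : ℝ | |s| < β / 2} = Metric.ball 0 (β / 2) := by ext s; simp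
    rw [hball] at hv
    exact (Metric.measure_ball_pos volume 0 ht).ne' hv
  · have hval : 2 * (gaussianPDFReal 0 1 (β / 2) / (β / 2))
        = √(8 / (Real.pi * β ^ 2)) * Real.exp (-(β ^ 2) / 8) := by
      have h1 : √(8 / (Real.pi * β ^ 2)) = 4 / β * (√(2 * Real.pi))⁻¹ := by
        rw [Real.sqrt_eq_iff_mul_self_eq (by positivity) (by positivity)]
        have h2 : (2 * Real.pi)⁻¹ = (√(2 * Real.pi))⁻¹ * (√(2 * Real.pi))⁻¹ := by
          rw [← mul_inv, Real.mul_self_sqrt (by positivity)]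
        calc 8 / (Real.pi * β ^ 2) = 16 / β ^ 2 * (2 * Real.pi)⁻¹ := by field_simp; norm_num
          _ = 4 / β * (√(2 * Real.pi))⁻¹ * (4 / β * (√(2 * Real.pi))⁻¹) := by
              rw [h2]; ring
      rw [h1, gaussianPDFReal_def]
      simp only [NNReal.coe_one, mul_one, sub_zero]
      have h3 : -(β / 2) ^ 2 / 2 = -β ^ 2 / 8 := by ring
      rw [h3]
      field_simp
      norm_num
    linarith

theorem gaussianReal_le_volume (A : Set ℝ) : gaussianReal 0 1 A ≤ volume A := by
  rw [gaussianReal_apply 0 one_ne_zero]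
  refine (lintegral_mono (g := fun _ => 1) fun s => ?_).trans (by simp)
  rw [gaussianPDF_def, ENNReal.ofReal_le_one]
  simp only [gaussianPDFReal_def, NNReal.coe_one, mul_one, sub_zero]
  refine mul_le_one₀ (inv_le_one_of_one_le₀ ?_) (Real.exp_pos _).le (Real.exp_le_one_iff.2 ?_)
  · rw [Real.one_le_sqrt]
    linarith [Real.pi_gt_three]
  · have := sq_nonneg s
    linarith

/-- A nonzero linear functional of a Gaussian vector has a bounded density, so that it falls into
short intervals with small probability, uniformly in the centre `a`. -/
theorem exists_measureReal_abs_lt_le {u : EuclideanSpace ℝ (Fin n)} (hu : u ≠ 0) {η : ℝ}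
    (hη : 0 < η) : ∃ ε : ℝ, 0 < ε ∧ ∀ a : ℝ,
      (stdGaussian (EuclideanSpace ℝ (Fin n))).real {z | |a + inner ℝ u z| < ε} ≤ η := by
  have hc : 0 < ‖u‖ := norm_pos_iff.2 hu
  refine ⟨η * ‖u‖ / 2, by positivity, fun a => ?_⟩
  have e : {z : EuclideanSpace ℝ (Fin n) | |a + inner ℝ u z| < η * ‖u‖ / 2}
      = {z | inner ℝ (‖u‖⁻¹ • u) z ∈ Metric.ball (-(a / ‖u‖)) (η / 2)} := by
    ext z
    simp only [Set.mem_ofPred_eq, Metric.mem_ball, Real.dist_eq, inner_smul_left]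
    have : a + inner ℝ u z = ‖u‖ * (‖u‖⁻¹ * inner ℝ u z - -(a / ‖u‖)) := by
      field_simp
      ring
    rw [this, abs_mul, abs_of_pos hc, mul_comm η, mul_div_assoc, mul_lt_mul_iff_right₀ hc]
    simp
  have hn : ‖‖u‖⁻¹ • u‖ = 1 := by rw [norm_smul, norm_inv, norm_norm, inv_mul_cancel₀ hc.ne']
  rw [e, measureReal_inner_mem hn Metric.isOpen_ball.measurableSet]
  refine ENNReal.toReal_le_of_le_ofReal hη.le ((gaussianReal_le_volume _).trans_eq ?_)
  rw [Real.volume_ball]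
  congr 1
  ring

theorem multivariateGaussian_smul_one (σ : ℝ) :
    multivariateGaussian 0 (σ ^ 2 • (1 : Matrix (Fin n) (Fin n) ℝ))
      = (stdGaussian (EuclideanSpace ℝ (Fin n))).map (σ • ·) := by
  apply Measure.ext_of_charFun
  ext u
  rw [charFun_map_smul, charFun_stdGaussian,
    charFun_multivariateGaussian (Matrix.PosSemidef.one.smul (sq_nonneg σ))]
  congr 1
  have : u.ofLp ⬝ᵥ ((σ ^ 2 • (1 : Matrix (Fin n) (Fin n) ℝ)).mulVec u.ofLp) = ‖σ • u‖ ^ 2 := by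
    rw [norm_smul, mul_pow, EuclideanSpace.real_norm_sq_eq, Matrix.smul_mulVec, Matrix.one_mulVec,
      dotProduct_smul, dotProduct, Real.norm_eq_abs, sq_abs, smul_eq_mul]
    simp [pow_two]
  rw [this]
  simp
  ring

/-! ### The selection loop and the refinement step -/

variable {p d : ℕ}

theorem rank_subDict (Ω : Matrix (Fin p) (Fin d) ℝ) (S : Finset (Fin p)) :
    (subDict Ω S).rank = Module.finrank ℝ (Submodule.span ℝ (row Ω '' (S : Set (Fin p)))) := by
  rw [Matrix.rank_eq_finrank_span_row]
  have h : row Ω '' (S : Set (Fin p)) = (WithLp.linearEquiv 2 ℝ (Fin d → ℝ)).symm ''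
      Set.range (subDict Ω S).row := by
    rw [← Set.range_comp, Set.image_eq_range]
    rfl
  rw [h]
  have := Submodule.map_span (WithLp.linearEquiv 2 ℝ (Fin d → ℝ)).symm.toLinearMap
    (Set.range (subDict Ω S).row)
  rw [LinearEquiv.coe_coe] at this
  rw [← this]
  exact (LinearEquiv.finrank_map_eq _ _).symm

theorem rank_subDict_mono (Ω : Matrix (Fin p) (Fin d) ℝ) {S T : Finset (Fin p)} (h : S ⊆ T) :
    (subDict Ω S).rank ≤ (subDict Ω T).rank := by
  rw [rank_subDict, rank_subDict]
  exact Submodule.finrank_mono (Submodule.span_mono (Set.image_mono (by exact_mod_cast h)))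

/-- The rows of `Λ` have a subfamily that is a basis of their span. -/
theorem exists_subset_card_eq_rank (Ω : Matrix (Fin p) (Fin d) ℝ) (Λ : Finset (Fin p)) :
    ∃ J ⊆ Λ, J.card = (subDict Ω Λ).rank ∧ (subDict Ω J).rank = (subDict Ω Λ).rank := by
  classical
  obtain ⟨b, hb, -, hsp, hli⟩ := exists_linearIndepOn_extension (K := ℝ) (v := row Ω)
    (linearIndepOn_empty ℝ _) (Set.empty_subset (Λ : Set (Fin p)))
  have hspan : Submodule.span ℝ (row Ω '' b) = Submodule.span ℝ (row Ω '' (Λ : Set (Fin p))) :=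
    le_antisymm (Submodule.span_mono (Set.image_mono hb)) (Submodule.span_le.2 hsp)
  have hrank : (subDict Ω b.toFinset).rank = (subDict Ω Λ).rank := by
    rw [rank_subDict, rank_subDict, Set.coe_toFinset, hspan]
  refine ⟨b.toFinset, by simpa [← Finset.coe_subset] using hb, ?_, hrank⟩
  rw [← hrank, rank_subDict, Set.coe_toFinset, Set.image_eq_range, Set.toFinset_card]
  exact (finrank_span_eq_card hli).symm

/-- If some subfamily `J` of `Λ` that reaches the target rank has smaller values of `v` than all
indices outside `Λ`, the loop stops before it meets an index outside `Λ`. -/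
theorem selectLoop_subset (Ω : Matrix (Fin p) (Fin d) ℝ) {k : ℕ} {J Λ : Finset (Fin p)}
    {v : Fin p → ℝ} (hJ : k ≤ (subDict Ω J).rank) (hv : ∀ j ∈ J, ∀ i ∉ Λ, v j < v i)
    (L : List (Fin p)) (S : Finset (Fin p)) (hL : L.Pairwise fun i j => v i ≤ v j)
    (hJS : ∀ j ∈ J, j ∈ S ∨ j ∈ L) (hS : S ⊆ Λ) :
    selectLoop Ω k L S ⊆ Λ ∧ k ≤ (subDict Ω (selectLoop Ω k L S)).rank := by
  induction L generalizing S with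
  | nil =>
    simp only [selectLoop]
    exact ⟨hS, hJ.trans (rank_subDict_mono Ω fun j hj => by simpa using hJS j hj)⟩
  | cons i L ih =>
    rw [List.pairwise_cons] at hL
    by_cases hk : (subDict Ω S).rank < k
    · rw [show selectLoop Ω k (i :: L) S = selectLoop Ω k L (insert i S) from if_pos hk]
      refine ih _ hL.2 (fun j hj => ?_) (Finset.insert_subset ?_ hS)
      · rcases hJS j hj with h | h
        · exact .inl (Finset.mem_insert_of_mem h)
        · rcases List.mem_cons.1 h with rfl | h
          · exact .inl (Finset.mem_insert_self _ _)
          · exact .inr h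
      · by_contra hi
        -- the rank of `S` is too small for `S` to contain `J`
        obtain ⟨j, hj, hjS⟩ : ∃ j ∈ J, j ∉ S := by
          by_contra! hsub
          exact absurd (hJ.trans (rank_subDict_mono Ω hsub)) (not_le.2 hk)
        have hlt := hv j hj i hi
        rcases List.mem_cons.1 ((hJS j hj).resolve_left hjS) with rfl | h
        · exact lt_irrefl _ hlt
        · exact absurd (hL.1 j h) (not_le.2 hlt)
    · rw [show selectLoop Ω k (i :: L) S = S from if_neg hk]
      exact ⟨hS, not_lt.1 hk⟩

/-- The part of the row `w_j` that is orthogonal to the rows indexed by `Λ`. -/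
noncomputable def residual (Ω : Matrix (Fin p) (Fin d) ℝ) (Λ : Finset (Fin p)) (j : Fin p) :
    EuclideanSpace ℝ (Fin d) :=
  (Submodule.span ℝ (row Ω '' (Λ : Set (Fin p))))ᗮ.starProjection (row Ω j)

theorem inner_row_project (Ω : Matrix (Fin p) (Fin d) ℝ) (Λ : Finset (Fin p)) (j : Fin p)
    (y : EuclideanSpace ℝ (Fin d)) :
    inner ℝ (row Ω j) (project Ω Λ y) = inner ℝ (residual Ω Λ j) y :=
  (Submodule.inner_starProjection_left_eq_right _ _ _).symm

theorem residual_of_mem (Ω : Matrix (Fin p) (Fin d) ℝ) {Λ : Finset (Fin p)} {j : Fin p}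
    (hj : j ∈ Λ) : residual Ω Λ j = 0 := by
  rw [residual, Submodule.starProjection_apply_eq_zero_iff]
  exact Submodule.le_orthogonal_orthogonal _ (Submodule.subset_span ⟨j, hj, rfl⟩)

theorem mem_cosupport {Ω : Matrix (Fin p) (Fin d) ℝ} {x : EuclideanSpace ℝ (Fin d)} {j : Fin p} :
    j ∈ cosupport Ω x ↔ inner ℝ (row Ω j) x = 0 := by
  simp [cosupport]

/-- Removing from `w_j` its component in the span of the rows of the co-support does not change the
inner product with `x`, which is orthogonal to that span. -/
theorem inner_residual_cosupport (Ω : Matrix (Fin p) (Fin d) ℝ) (x : EuclideanSpace ℝ (Fin d))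
    (j : Fin p) : inner ℝ (residual Ω (cosupport Ω x) j) x = inner ℝ (row Ω j) x := by
  rw [← inner_row_project, project, Submodule.starProjection_eq_self_iff.2]
  rw [Submodule.mem_orthogonal]
  intro u hu
  induction hu using Submodule.span_induction with
  | mem u hu =>
    obtain ⟨i, hi, rfl⟩ := hu
    exact mem_cosupport.1 (by simpa using hi)
  | zero => simp
  | add u v _ _ hu hv => rw [inner_add_left, hu, hv, add_zero]
  | smul c u _ hu => rw [inner_smul_left, hu, mul_zero]

theorem residual_ne_zero {Ω : Matrix (Fin p) (Fin d) ℝ} {x : EuclideanSpace ℝ (Fin d)} {j : Fin p}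
    (hj : j ∉ cosupport Ω x) : residual Ω (cosupport Ω x) j ≠ 0 := by
  intro h
  apply hj
  rw [mem_cosupport, ← inner_residual_cosupport, h, inner_zero_left]

/-- The algorithm recovers the co-support as soon as a subfamily `J` of full rank comes first in
the sorting step, and the noise does not cancel the rows outside the co-support in the refinement
step. -/
theorem recovers_of_lt {Ω : Matrix (Fin p) (Fin d) ℝ} {Λ J : Finset (Fin p)} {ε : ℝ} (hε : 0 < ε)
    {y : EuclideanSpace ℝ (Fin d)} (hJ : (subDict Ω J).rank = (subDict Ω Λ).rank)
    (hsort : ∀ j ∈ J, ∀ i ∉ Λ, |inner ℝ (row Ω j) y| < |inner ℝ (row Ω i) y|)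
    (hrefine : ∀ i ∉ Λ, ε ≤ |inner ℝ (residual Ω Λ i) y|) :
    Recovers Ω (subDict Ω Λ).rank ε y Λ := by
  intro Γ hΓ
  obtain ⟨hsub, hrank⟩ := selectLoop_subset Ω (k := (subDict Ω Λ).rank)
    (v := fun i => |inner ℝ (row Ω i) y|) hJ.ge hsort (List.ofFn Γ) ∅
    (List.pairwise_ofFn.2 fun i j hij => hΓ hij.le)
    (fun j _ => .inr (List.mem_ofFn.2 ⟨Γ.symm j, by simp⟩)) (Finset.empty_subset _)
  have hspan : Submodule.span ℝ (row Ω '' (selectRows Ω (subDict Ω Λ).rank Γ : Set (Fin p)))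
      = Submodule.span ℝ (row Ω '' (Λ : Set (Fin p))) := by
    refine Submodule.eq_of_le_of_finrank_le
      (Submodule.span_mono (Set.image_mono (by exact_mod_cast hsub))) ?_
    rwa [← rank_subDict, ← rank_subDict]
  have hproj : project Ω (selectRows Ω (subDict Ω Λ).rank Γ) y = project Ω Λ y := by
    simp only [project, hspan]
  ext j
  simp only [thresholding, hproj, inner_row_project, Finset.mem_filter_univ]
  by_cases hj : j ∈ Λ
  · simp [hj, residual_of_mem Ω hj, hε]
  · simpa [hj] using hrefine j hj

/-! ### Probability of recovery -/

/-- Recovery in terms of the standardized noise `z`. Half of the margin `βσ` is spent on the rows of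
`J`, the other half on the rows outside the co-support. -/
theorem recovers_add_smul {Ω : Matrix (Fin p) (Fin d) ℝ} {σ β ε : ℝ} (hσ : 0 < σ) (hε : 0 < ε)
    {x z : EuclideanSpace ℝ (Fin d)} {J : Finset (Fin p)} (hJ : J ⊆ cosupport Ω x)
    (hrank : (subDict Ω J).rank = (subDict Ω (cosupport Ω x)).rank)
    (hz : ∀ i ∉ cosupport Ω x, β * σ ≤ |inner ℝ (row Ω i) x|)
    (hJz : ∀ j ∈ J, |inner ℝ (row Ω j) z| < β / 2)
    (hΛz : ∀ i ∉ cosupport Ω x, |inner ℝ (row Ω i) z| < β / 2)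
    (href : ∀ i ∉ cosupport Ω x, ε ≤ |inner ℝ (row Ω i) x
      + inner ℝ (σ • residual Ω (cosupport Ω x) i) z|) :
    Recovers Ω (subDict Ω (cosupport Ω x)).rank ε (x + σ • z) (cosupport Ω x) := by
  refine recovers_of_lt hε hrank (fun j hj i hi => ?_) fun i hi => ?_
  · rw [inner_add_right, inner_add_right, mem_cosupport.1 (hJ hj), zero_add, inner_smul_right,
      inner_smul_right, abs_mul, abs_of_pos hσ]
    have h1 := abs_sub_abs_le_abs_sub (inner ℝ (row Ω i) x) (-(σ * inner ℝ (row Ω i) z))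
    rw [abs_neg, sub_neg_eq_add, abs_mul, abs_of_pos hσ] at h1
    have h2 := mul_lt_mul_of_pos_left (hΛz i hi) hσ
    have h3 := mul_lt_mul_of_pos_left (hJz j hj) hσ
    have h4 := hz i hi
    linarith
  · have h := href i hi
    rwa [inner_smul_left, ← inner_residual_cosupport, RCLike.conj_to_real, ← inner_smul_right,
      ← inner_add_right] at h

/-- The good event has at least the probability that Šidák's inequality gives for its slabs, less
the union bound for the failures of the refinement step. -/
theorem le_measureReal_good {Ω : Matrix (Fin p) (Fin d) ℝ} (hΩ : ∀ j, ‖row Ω j‖ = 1)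
    {β η ε σ : ℝ} (hβ : 0 < β) {x : EuclideanSpace ℝ (Fin d)} {J : Finset (Fin p)}
    (hJ : J ⊆ cosupport Ω x)
    (hη : ∀ i ∉ cosupport Ω x, (stdGaussian (EuclideanSpace ℝ (Fin d))).real
      {z | |inner ℝ (row Ω i) x + inner ℝ (σ • residual Ω (cosupport Ω x) i) z| < ε} ≤ η) :
    (gaussianReal 0 1).real {s | |s| < β / 2} ^ ((p - (cosupport Ω x).card) + J.card)
        - (p - (cosupport Ω x).card : ℕ) * η
      ≤ (stdGaussian (EuclideanSpace ℝ (Fin d))).real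
        ({z | ∀ j ∈ (cosupport Ω x)ᶜ ∪ J, |inner ℝ (row Ω j) z| < β / 2} \
          ⋃ i ∈ (cosupport Ω x)ᶜ, {z | |inner ℝ (row Ω i) x
            + inner ℝ (σ • residual Ω (cosupport Ω x) i) z| < ε}) := by
  have hcc : (cosupport Ω x)ᶜ.card = p - (cosupport Ω x).card := by
    rw [Finset.card_compl, Fintype.card_fin]
  have hcard : ((cosupport Ω x)ᶜ ∪ J).card = (p - (cosupport Ω x).card) + J.card := by
    rw [Finset.card_union_of_disjoint, hcc]
    exact disjoint_compl_left.mono_right hJ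
  have h1 := pow_card_le_measureReal_slabs ((cosupport Ω x)ᶜ ∪ J) hΩ (half_pos hβ)
  rw [hcard] at h1
  have h2 := (measureReal_biUnion_finset_le (μ := stdGaussian (EuclideanSpace ℝ (Fin d)))
    (cosupport Ω x)ᶜ fun i => {z | |inner ℝ (row Ω i) x
      + inner ℝ (σ • residual Ω (cosupport Ω x) i) z| < ε}).trans
    (Finset.sum_le_card_nsmul _ _ η fun i hi => hη i (Finset.mem_compl.1 hi))
  rw [hcc, nsmul_eq_mul] at h2
  exact (sub_le_sub h1 h2).trans (le_measureReal_sdiff (measure_ne_top _ _))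

end AnalysisModel

theorem theorem1 {p d : ℕ} (Ω : Matrix (Fin p) (Fin d) ℝ)
    (hΩ : ∀ j, ‖AnalysisModel.row Ω j‖ = 1)
    (σ β : ℝ) (hσ : 0 < σ) (hβ : 0 < β) :
    ∃ ε : ℝ, 0 < ε ∧ ∀ ε₀ : ℝ, 0 < ε₀ → ε₀ ≤ ε →
      ∀ (x : EuclideanSpace ℝ (Fin d)) (Λ : Finset (Fin p)) (l r : ℕ),
        Λ = AnalysisModel.cosupport Ω x →
        l = Λ.card →
        r ≤ d →
        (AnalysisModel.subDict Ω Λ).rank = d - r →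
        ((β * σ : ℝ) : EReal) ≤ AnalysisModel.zMin Ω x →
        ∀ {S : Type*} [MeasurableSpace S] (P : Measure S) [IsProbabilityMeasure P]
          (e : S → EuclideanSpace ℝ (Fin d)),
          HasLaw e (multivariateGaussian 0 (σ ^ 2 • (1 : Matrix (Fin d) (Fin d) ℝ))) P →
          ENNReal.ofReal (AnalysisModel.g β ^ ((p - l) + (d - r))) ≤
            P {s | AnalysisModel.Recovers Ω (d - r) ε₀ (x + e s) Λ} := by
  open AnalysisModel in
  have hg0 : 0 ≤ g β := le_max_left _ _
  -- the room left by the strict Mills bound, uniformly over the exponents that can occur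
  obtain ⟨δ, hδ, hδg⟩ := Pi.exists_forall_pos_add_lt
    (x := fun m : Fin (p + d) => g β ^ ((m : ℕ) + 1))
    (y := fun m => (gaussianReal 0 1).real {s | |s| < β / 2} ^ ((m : ℕ) + 1))
    fun m => pow_lt_pow_left₀ (g_lt_measureReal hβ) hg0 (Nat.succ_ne_zero _)
  have hη : 0 < δ / (p + 1) := by positivity
  have hex : ∀ q : Finset (Fin p) × Fin p, ∃ ε : ℝ, 0 < ε ∧ (residual Ω q.1 q.2 ≠ 0 → ∀ a : ℝ,
      (stdGaussian (EuclideanSpace ℝ (Fin d))).real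
        {z | |a + inner ℝ (σ • residual Ω q.1 q.2) z| < ε} ≤ δ / (p + 1)) := by
    intro q
    by_cases h : residual Ω q.1 q.2 = 0
    · exact ⟨1, one_pos, fun h' => absurd h h'⟩
    · obtain ⟨ε, hε, H⟩ := exists_measureReal_abs_lt_le (smul_ne_zero hσ.ne' h) hη
      exact ⟨ε, hε, fun _ => H⟩
  choose E hE hEη using hex
  obtain ⟨ε, hε, hεE⟩ := Pi.exists_forall_pos_add_lt (x := fun _ => (0 : ℝ)) (y := E) hE
  refine ⟨ε, hε, fun ε₀ hε₀ hle x Λ l r hΛ hl _ hrank hz S _ P _ e he => ?_⟩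
  subst hΛ hl
  obtain ⟨J, hJ, hJcard, hJrank⟩ := exists_subset_card_eq_rank Ω (cosupport Ω x)
  have hz' : ∀ i ∉ cosupport Ω x, β * σ ≤ |inner ℝ (row Ω i) x| := fun i hi =>
    EReal.coe_le_coe_iff.1 (hz.trans (iInf₂_le i (Finset.mem_compl.2 hi)))
  have hgood := le_measureReal_good hΩ (σ := σ) (ε := ε₀) (η := δ / (p + 1)) hβ hJ fun i hi => by
    refine (measureReal_mono fun z hz => ?_).trans
      (hEη (cosupport Ω x, i) (residual_ne_zero hi) (inner ℝ (row Ω i) x))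
    refine lt_of_lt_of_le hz (hle.trans ?_)
    simpa using (hεE (cosupport Ω x, i)).le
  set G : Set (EuclideanSpace ℝ (Fin d)) :=
    {z | ∀ j ∈ (cosupport Ω x)ᶜ ∪ J, |inner ℝ (row Ω j) z| < β / 2} \
          ⋃ i ∈ (cosupport Ω x)ᶜ, {z | |inner ℝ (row Ω i) x
            + inner ℝ (σ • residual Ω (cosupport Ω x) i) z| < ε₀} with hG
  have hGm : MeasurableSet G := by
    refine MeasurableSet.diff ?_ (Finset.measurableSet_biUnion _ fun i _ =>
      measurableSet_lt (by fun_prop) measurable_const)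
    simp only [Set.ofPred_forall]
    exact Finset.measurableSet_biInter _ fun i _ =>
      measurableSet_lt (by fun_prop) measurable_const
  rw [hJcard, hrank] at hgood
  -- the bound `g ^ m` on the good event; without rows outside the co-support no room is needed
  have hbound : g β ^ ((p - (cosupport Ω x).card) + (d - r))
      ≤ (stdGaussian (EuclideanSpace ℝ (Fin d))).real G := by
    refine le_trans ?_ hgood
    rcases Nat.eq_zero_or_pos (p - (cosupport Ω x).card) with h0 | h0
    · simp only [h0, Nat.cast_zero, zero_mul, sub_zero]
      exact pow_le_pow_left₀ hg0 (g_lt_measureReal hβ).le _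
    · have hm := hδg ⟨(p - (cosupport Ω x).card) + (d - r) - 1, by omega⟩
      simp only [Nat.sub_add_cancel (show 1 ≤ (p - (cosupport Ω x).card) + (d - r) by omega)] at hm
      have hp : ((p - (cosupport Ω x).card : ℕ) : ℝ) * (δ / (p + 1)) ≤ δ := by
        have h1 : ((p - (cosupport Ω x).card : ℕ) : ℝ) ≤ p + 1 := by
          exact_mod_cast (Nat.sub_le _ _).trans (Nat.le_succ _)
        calc _ ≤ (p + 1 : ℝ) * (δ / (p + 1)) := by gcongr
          _ = δ := by field_simp
      linarith
  have hσm : MeasurableSet ((fun v : EuclideanSpace ℝ (Fin d) => σ⁻¹ • v) ⁻¹' G) :=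
    (measurable_const_smul _) hGm
  calc ENNReal.ofReal (g β ^ ((p - (cosupport Ω x).card) + (d - r)))
      ≤ stdGaussian (EuclideanSpace ℝ (Fin d)) G := by
        rw [← ofReal_measureReal]
        exact ENNReal.ofReal_le_ofReal hbound
    _ = P (e ⁻¹' ((fun v => σ⁻¹ • v) ⁻¹' G)) := by
        rw [← Measure.map_apply_of_aemeasurable he.aemeasurable hσm, he.map_eq,
          multivariateGaussian_smul_one, Measure.map_apply (measurable_const_smul _) hσm]
        congr 1
        ext z
        simp [smul_smul, inv_mul_cancel₀ hσ.ne']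
    _ ≤ P {s | Recovers Ω (d - r) ε₀ (x + e s) (cosupport Ω x)} := by
        refine measure_mono fun s hs => ?_
        obtain ⟨hs1, hs2⟩ : σ⁻¹ • e s ∈ G := hs
        simp only [Set.mem_iUnion, not_exists, Set.mem_ofPred_eq, not_lt, Finset.mem_compl,
          Finset.mem_union] at hs1 hs2
        have := recovers_add_smul hσ hε₀ hJ hJrank hz' (fun j hj => hs1 j (.inr hj))
          (fun i hi => hs1 i (.inl hi)) hs2
        rwa [smul_inv_smul₀ hσ.ne', hrank] at this
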